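/- Let $n\ge 0$ be an integer and, for $k\ge 0$, let $[k]_q=\frac{1-q^k}{1-q}=1+q+\dots+q^{k-1}$; all identities below are identities of polynomials in $q$. A Motzkin path of length $m$ is a lattice path from $(0,0)$ to $(m,0)$ with steps $U=(1,1)$, $D=(1,-1)$, $L=(1,0)$ that never goes below the $x$-axis; a Dyck path is a Motzkin path without steps $L$, and $\mathcal D_{2n}$ is the set of Dyck paths of length $2n$. The height $h_i(\mu)$ of the $i$-th step of $\mu$ is the larger of the $y$-coordinates of its endpoints. A labeling $\lambda$ of $\mu=\mu_1\cdots\mu_m$ assigns to each down step $\mu_i=D$ an integer $\lambda_i$ with $1\le\lambda_i\le h_i(\mu)$. Put $$H(\mu,\lambda)=\sum_{i:\,\mu_i=D}(\lambda_i-1)+\sum_{i:\,\mu_i\ne D}h_i(\mu),\qquad H[\mu;q]=\sum_{\lambda}q^{H(\mu,\lambda)},$$ the last sum being over all labelings $\lambda$ of $\mu$, and $$\tilde H[\mu;q]=\prod_{i:\,\mu_i=D}[h_i(\mu)]_q\prod_{i:\,\mu_i=U}q^{h_i(\mu)-1}\prod_{i:\,\mu_i=L}q^{h_i(\mu)}.$$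 For $\pi\in\mathfrak S_{m}$ let $\ell(\pi)$ be the number of pairs $i<j$ with $\pi(i)>\pi(j)$. Bruhat order on $\mathfrak S_m$ is the reflexive and transitive closure of the relations $\pi<(i\;j)\pi$ with $\ell((i\;j)\pi)=\ell(\pi)+1$. Let $\mathcal I^{FPF}_{2n}$ be the set of fixed-point-free involutions in $\mathfrak S_{2n}$, with the partial order induced by Bruhat order. Then $\mathcal I^{FPF}_{2n}$ is a graded poset: it has a (unique) rank function $r:\mathcal I^{FPF}_{2n}\to\mathbb N$, that is, a strictly increasing function that rises by exactly $1$ along each cover relation and is $0$ at minimal elements. Its rank generating function $R_{\mathcal I^{FPF}_{2n}}(q)=\sum_{\tau}q^{r(\tau)}$ satisfies $$\sum_{\delta\in\mathcal D_{2n}}H[\delta;q]=q^n R_{\mathcal I^{FPF}_{2n}}(q)=q^n\prod_{k=1}^n[2k-1]_q .$$ Moreover $H[\delta;q]=q^n\tilde H[\delta;q]$ for every $\delta\in\mathcal D_{2n}$, so that this is equivalent to the identity $$\sum_{\delta\in\mathcal D_{2n}}\tilde H[\delta;q]=R_{\mathcal I^{FPF}_{2n}}(q)=\prod_{k=1}^n[2k-1]_q,$$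 which therefore holds as well. -/

import Mathlib

namespace BruhatMotzkin

open Polynomial

/-! ### Lattice paths -/

/-- The steps `U = (1, 1)`, `D = (1, -1)` and `L = (1, 0)` of a lattice path. -/
inductive Step
  | U : Step
  | D : Step
  | L : Step
  deriving DecidableEq

instance : Fintype Step where
  elems := {Step.U, Step.D, Step.L}
  complete s := by cases s <;> decide

/-- The vertical displacement of a step. -/
def Step.rise : Step → ℤ
  | Step.U => 1
  | Step.D => -1
  | Step.L => 0

/-- The `y`-coordinate reached after the first `k` steps of the path `w` that starts at `(0, 0)`. -/
def level {m : ℕ} (w : Fin m → Step) (k : ℕ) : ℤ :=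
  ∑ j : Fin m with j.val < k, (w j).rise

/-- `w` is a Motzkin path of length `m`: it never goes below the `x`-axis and ends at `(m, 0)`. -/
def IsMotzkin {m : ℕ} (w : Fin m → Step) : Prop :=
  (∀ k ≤ m, 0 ≤ level w k) ∧ level w m = 0

instance {m : ℕ} (w : Fin m → Step) : Decidable (IsMotzkin w) :=
  inferInstanceAs (Decidable ((∀ k ≤ m, 0 ≤ level w k) ∧ level w m = 0))

/-- The Motzkin paths of length `m`. -/
def motzkinPaths (m : ℕ) : Finset (Fin m → Step) :=
  Finset.univ.filter IsMotzkin

/-- The Dyck paths of length `2 * n`: the Motzkin paths without horizontal steps. -/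
def dyckPaths (n : ℕ) : Finset (Fin (2 * n) → Step) :=
  (motzkinPaths (2 * n)).filter fun w => ∀ i, w i ≠ Step.L

/-- The height of a step: the larger of the `y`-coordinates of its two endpoints (on a Motzkin path
these are nonnegative, so that nothing is truncated). -/
def height {m : ℕ} (w : Fin m → Step) (i : Fin m) : ℕ :=
  (max (level w i.val) (level w (i.val + 1))).toNat

/-- The labelings of `w`: a down step `i` carries a label in `{1, …, height w i}`; the other steps
carry no label, which is encoded by the value `0`. -/
def labelings {m : ℕ} (w : Fin m → Step) : Finset (Fin m → ℕ) :=
  Fintype.piFinset fun i => if w i = Step.D then Finset.Icc 1 (height w i) else {0}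

/-- The statistic `H(w, l)` of a labeled path. -/
def labeledStat {m : ℕ} (w : Fin m → Step) (l : Fin m → ℕ) : ℕ :=
  ∑ i, if w i = Step.D then l i - 1 else height w i

/-- The generating function `H[w; q]`, the sum of `q ^ H(w, l)` over all labelings `l` of `w`. -/
noncomputable def pathGF {m : ℕ} (w : Fin m → Step) : ℤ[X] :=
  ∑ l ∈ labelings w, X ^ labeledStat w l

/-- The `q`-integer `[k]_q = 1 + q + ⋯ + q ^ (k - 1)`. -/
noncomputable def qInt (k : ℕ) : ℤ[X] :=
  ∑ i ∈ Finset.range k, X ^ i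

/-- `[k]_q = (1 - q ^ k) / (1 - q)`. -/
theorem qInt_mul_one_sub (k : ℕ) : qInt k * (1 - X) = 1 - X ^ k :=
  geom_sum_mul_neg X k

/-- The generating function with one factor `q` omitted for each up step: the product over the
steps of `[h]_q` for a down step, `q ^ h` for a horizontal step and `q ^ (h - 1)` for an up step,
`h` being the height of the step (`h ≥ 1` for an up step of a Motzkin path). -/
noncomputable def pathGFTilde {m : ℕ} (w : Fin m → Step) : ℤ[X] :=
  ∏ i, match w i with
    | Step.U => X ^ (height w i - 1)
    | Step.D => qInt (height w i)
    | Step.L => X ^ height w i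

/-! ### Bruhat order -/

/-- The inversions of a permutation. -/
def inversions {m : ℕ} (π : Equiv.Perm (Fin m)) : Finset (Fin m × Fin m) :=
  Finset.univ.filter fun p => p.1 < p.2 ∧ π p.2 < π p.1

/-- The number of inversions of a permutation. -/
def length {m : ℕ} (π : Equiv.Perm (Fin m)) : ℕ :=
  (inversions π).card

/-- The relation generating Bruhat order: `ρ = (i j) π` has exactly one inversion more than `π`. -/
def BruhatStep {m : ℕ} (π ρ : Equiv.Perm (Fin m)) : Prop :=
  ∃ i j : Fin m, i ≠ j ∧ ρ = Equiv.swap i j * π ∧ length ρ = length π + 1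

/-- Bruhat order on the symmetric group. -/
def BruhatLE {m : ℕ} (π ρ : Equiv.Perm (Fin m)) : Prop :=
  Relation.ReflTransGen BruhatStep π ρ

theorem BruhatLE.eq_or_length_lt {m : ℕ} {π ρ : Equiv.Perm (Fin m)} (h : BruhatLE π ρ) :
    π = ρ ∨ length π < length ρ := by
  induction h with
  | refl => exact Or.inl rfl
  | tail _ hstep ih =>
    obtain ⟨i, j, _, _, hl⟩ := hstep
    rcases ih with rfl | ih
    · right; omega
    · right; omega

theorem BruhatLE.antisymm {m : ℕ} {π ρ : Equiv.Perm (Fin m)} (h : BruhatLE π ρ)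
    (h' : BruhatLE ρ π) : π = ρ := by
  rcases h.eq_or_length_lt with e | e
  · exact e
  · rcases h'.eq_or_length_lt with e' | e'
    · exact e'.symm
    · omega

/-- The fixed-point-free involutions of `2 * n` points. -/
def FPFInvolution (n : ℕ) : Type :=
  {τ : Equiv.Perm (Fin (2 * n)) // τ * τ = 1 ∧ ∀ i, τ i ≠ i}

instance (n : ℕ) : Fintype (FPFInvolution n) :=
  inferInstanceAs
    (Fintype {τ : Equiv.Perm (Fin (2 * n)) // τ * τ = 1 ∧ ∀ i, τ i ≠ i})

/-- The partial order that Bruhat order induces on the fixed-point-free involutions. -/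
instance (n : ℕ) : PartialOrder (FPFInvolution n) where
  le σ τ := BruhatLE σ.1 τ.1
  le_refl _ := Relation.ReflTransGen.refl
  le_trans _ _ _ h h' := Relation.ReflTransGen.trans h h'
  le_antisymm _ _ h h' := Subtype.ext (BruhatLE.antisymm h h')

/-- The rank generating function of a finite graded poset. The rank function `grade ℕ` is strictly
increasing, rises by exactly one along each cover relation and vanishes at the minimal elements. -/
noncomputable def rankGF (P : Type*) [Fintype P] [PartialOrder P] [GradeMinOrder ℕ P] : ℤ[X] :=
  ∑ p : P, X ^ grade ℕ p

end BruhatMotzkin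

/-!
The poset side and the path side are both evaluated in closed form, as `∏ [2k - 1]`.

For the poset, `bruhatLE_iff_rankLE` replaces Bruhat order by the entrywise comparison of rank
matrices, whose entries are the counts of the positions `k < a` with `π k < b`. In this form the
lifting properties of adjacent transpositions `s` are inequalities between neighbouring rows. For
fixed-point-free involutions multiplication is replaced by conjugation: `s * τ * s` is `τ` if `s` is
a cycle of `τ`, and otherwise its length differs from that of `τ` by two. The heart of the matter is
`FPFInvolution.exists_lt_le_length_eq`: if `σ < τ`, then some `ρ` with `σ < ρ ≤ τ` has length
`ℓ(σ) + 2`. It follows by induction on `τ` from the comparison of `σ` with `s * τ * s`, where `s` is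
a descent of `τ` that is not one of its cycles. If `s` is a cycle of `σ`, the comparison is
`RankLE.le_conj`, which depends on a parity: the number of points below `a` that a fixed-point-free
involution maps below `a` is even. Hence covers raise the length by exactly two. As
`(0 1)(2 3)(4 5)⋯`, of length `n`, is the minimum, `(ℓ(τ) - n) / 2` is a rank function, and the only
one, because every element is reached from the minimum by covers.

Removing the cycle of `0` from an involution on `2n + 2` points, where `0` is mapped to `k + 1`,
lowers the rank by `k` (`FPFInvolution.rank_insertPair`). The choices `0 ≤ k ≤ 2n` contribute the
factor `[2n + 1]`, which gives the product formula for the rank generating function.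

For the paths, `dyckSum m h` is the weighted sum over all ways to descend from height `h` to `0` in
`m` steps. Its recursion by the first step is solved by
`dyckSum (h + 2j) h = [2j + 1] ⋯ [2j + h] * ∏_{k ≤ j} [2k - 1]`, owing to
`[h] + q ^ h [2j] = [h + 2j]`. The generating function `H` factors over the steps of a path; each of
the `n` up steps has one factor `q` more than in the reduced generating function.
-/

namespace BruhatMotzkin

open Polynomial

/-! ### Lengths of permutations and transpositions -/

theorem length_eq_sum {m : ℕ} (π : Equiv.Perm (Fin m)) :
    length π = ∑ i, ∑ j, if i < j ∧ π j < π i then 1 else 0 := by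
  rw [length, inversions, Finset.card_filter, ← Finset.univ_product_univ, Finset.sum_product]

theorem sum_eq_add_add_sum_erase {m : ℕ} {p q : Fin m} (h : p ≠ q) (f : Fin m → ℕ) :
    ∑ k, f k = f p + f q + ∑ k ∈ (Finset.univ.erase p).erase q, f k := by
  rw [← Finset.add_sum_erase _ f (Finset.mem_univ p),
    ← Finset.add_sum_erase (Finset.univ.erase p) f (a := q) (by simp [h.symm]), add_assoc]

/-- Exchanging the values at positions `p < q` with `π p < π q` creates the inversion `(p, q)`, and
two more for each point of the graph of `π` strictly inside the rectangle spanned by the two. -/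
theorem length_mul_swap {m : ℕ} (π : Equiv.Perm (Fin m)) {p q : Fin m} (hpq : p < q)
    (hπ : π p < π q) :
    length (π * Equiv.swap p q) = length π + 1 +
      2 * (Finset.univ.filter fun x => p < x ∧ x < q ∧ π p < π x ∧ π x < π q).card := by
  have hne := hpq.ne
  set R := (Finset.univ.erase p).erase q with hR
  have hmem : ∀ x ∈ R, x ≠ p ∧ x ≠ q := fun x hx => by
    simp only [hR, Finset.mem_erase] at hx; exact ⟨hx.2.1, hx.1⟩
  have hsw : ∀ x ∈ R, (π * Equiv.swap p q) x = π x := fun x hx => by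
    rw [Equiv.Perm.mul_apply, Equiv.swap_apply_of_ne_of_ne (hmem x hx).1 (hmem x hx).2]
  have hp : (π * Equiv.swap p q) p = π q := by simp
  have hq : (π * Equiv.swap p q) q = π p := by simp
  -- the inversions of a permutation, sorted by how many of their entries lie in `{p, q}`
  have split : ∀ ρ : Equiv.Perm (Fin m), length ρ =
      (if ρ q < ρ p then 1 else 0) +
      (∑ x ∈ R, ((if p < x ∧ ρ x < ρ p then 1 else 0) + (if q < x ∧ ρ x < ρ q then 1 else 0) +
        (if x < p ∧ ρ p < ρ x then 1 else 0) + (if x < q ∧ ρ q < ρ x then 1 else 0))) +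
      ∑ x ∈ R, ∑ y ∈ R, if x < y ∧ ρ y < ρ x then 1 else 0 := by
    intro ρ
    rw [length_eq_sum, sum_eq_add_add_sum_erase hne]
    simp_rw [sum_eq_add_add_sum_erase hne (fun j => if _ < j ∧ ρ j < _ then 1 else 0)]
    rw [← hR]
    simp only [Finset.sum_add_distrib, lt_irrefl, false_and, if_false, hpq, true_and,
      not_lt.mpr hpq.le]
    ring
  have hbetween : (Finset.univ.filter fun x => p < x ∧ x < q ∧ π p < π x ∧ π x < π q).card =
      ∑ x ∈ R, if p < x ∧ x < q ∧ π p < π x ∧ π x < π q then 1 else 0 := by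
    rw [Finset.card_filter, sum_eq_add_add_sum_erase hne]
    simp [hR]
  rw [split, split, hbetween, hp, hq, if_pos hπ, if_neg (not_lt.mpr hπ.le), Finset.mul_sum]
  have h1 : ∀ x ∈ R, ∀ y ∈ R,
      (if x < y ∧ (π * Equiv.swap p q) y < (π * Equiv.swap p q) x then 1 else 0) =
        if x < y ∧ π y < π x then 1 else 0 := fun x hx y hy => by rw [hsw x hx, hsw y hy]
  rw [Finset.sum_congr rfl fun x hx => Finset.sum_congr rfl (h1 x hx)]
  have h2 : ∀ x ∈ R,
      ((if p < x ∧ (π * Equiv.swap p q) x < π q then 1 else 0) +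
        (if q < x ∧ (π * Equiv.swap p q) x < π p then 1 else 0) +
        (if x < p ∧ π q < (π * Equiv.swap p q) x then 1 else 0) +
        (if x < q ∧ π p < (π * Equiv.swap p q) x then 1 else 0)) =
      ((if p < x ∧ π x < π p then 1 else 0) + (if q < x ∧ π x < π q then 1 else 0) +
        (if x < p ∧ π p < π x then 1 else 0) + (if x < q ∧ π q < π x then 1 else 0)) +
      2 * if p < x ∧ x < q ∧ π p < π x ∧ π x < π q then 1 else 0 := by
    intro x hx
    rw [hsw x hx]
    obtain ⟨hxp, hxq⟩ := hmem x hx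
    have hxp' := fun h => hxp (π.injective h)
    have hxq' := fun h => hxq (π.injective h)
    rcases lt_or_gt_of_ne hxp with a | a <;> rcases lt_or_gt_of_ne hxq with b | b <;>
      rcases lt_or_gt_of_ne hxp' with c | c <;> rcases lt_or_gt_of_ne hxq' with d | d <;>
      simp only [a, b, c, d, not_lt.mpr (le_of_lt a), not_lt.mpr (le_of_lt b),
        not_lt.mpr (le_of_lt c), not_lt.mpr (le_of_lt d), true_and, false_and, and_false,
        if_true, if_false] <;> first | rfl | omega
  rw [Finset.sum_congr rfl h2, Finset.sum_add_distrib]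
  ring

theorem length_lt_length_mul_swap {m : ℕ} (π : Equiv.Perm (Fin m)) {p q : Fin m} (hpq : p < q)
    (hπ : π p < π q) : length π < length (π * Equiv.swap p q) := by
  rw [length_mul_swap π hpq hπ]; omega

theorem length_mul_swap_of_forall {m : ℕ} (π : Equiv.Perm (Fin m)) {p q : Fin m} (hpq : p < q)
    (hπ : π p < π q) (h : ∀ x, p < x → x < q → π p < π x → π q ≤ π x) :
    length (π * Equiv.swap p q) = length π + 1 := by
  rw [length_mul_swap π hpq hπ, Finset.filter_false_of_mem]
  · simp
  · rintro x - ⟨h1, h2, h3, h4⟩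
    exact absurd h4 (not_lt.mpr (h x h1 h2 h3))

/-! ### The rank matrix criterion for Bruhat order -/

/-- The number of positions `k < a` with `π k < b`, the `(a, b)` entry of the rank matrix of the
permutation matrix of `π`. -/
def rankCount {m : ℕ} (π : Equiv.Perm (Fin m)) (a b : ℕ) : ℕ :=
  ∑ k : Fin m, if k.val < a ∧ (π k).val < b then 1 else 0

/-- Entrywise comparison of the rank matrices, with the larger permutation having the smaller
entries. -/
def RankLE {m : ℕ} (σ τ : Equiv.Perm (Fin m)) : Prop :=
  ∀ a b, rankCount τ a b ≤ rankCount σ a b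

theorem RankLE.trans {m : ℕ} {π ρ σ : Equiv.Perm (Fin m)} (h : RankLE π ρ) (h' : RankLE ρ σ) :
    RankLE π σ := fun a b => (h' a b).trans (h a b)

theorem rankCount_inv {m : ℕ} (π : Equiv.Perm (Fin m)) (a b : ℕ) :
    rankCount π⁻¹ a b = rankCount π b a := by
  rw [rankCount, ← Equiv.sum_comp π]
  simp [rankCount, and_comm]

theorem RankLE.inv {m : ℕ} {σ τ : Equiv.Perm (Fin m)} (h : RankLE σ τ) : RankLE σ⁻¹ τ⁻¹ :=
  fun a b => by rw [rankCount_inv, rankCount_inv]; exact h b a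

theorem rankCount_succ {m : ℕ} (π : Equiv.Perm (Fin m)) (i : Fin m) (b : ℕ) :
    rankCount π (i.val + 1) b = rankCount π i.val b + if (π i).val < b then 1 else 0 := by
  rw [rankCount, rankCount, ← Finset.add_sum_erase _ _ (Finset.mem_univ i),
    ← Finset.add_sum_erase (a := i) Finset.univ (fun k : Fin m =>
      if k.val < i.val ∧ (π k).val < b then 1 else 0) (Finset.mem_univ i)]
  have : ∀ k ∈ Finset.univ.erase i, (if k.val < i.val + 1 ∧ (π k).val < b then 1 else 0) =
      if k.val < i.val ∧ (π k).val < b then 1 else 0 := by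
    intro k hk
    have : k.val ≠ i.val := fun h => (Finset.ne_of_mem_erase hk) (Fin.ext h)
    simp only [show k.val < i.val + 1 ↔ k.val < i.val by omega]
  rw [Finset.sum_congr rfl this]
  simp
  ring

theorem rankCount_mul_swap {m : ℕ} (π : Equiv.Perm (Fin m)) {p q : Fin m} (hpq : p < q)
    (hπ : π p < π q) (a b : ℕ) :
    rankCount π a b = rankCount (π * Equiv.swap p q) a b +
      if p.val < a ∧ a ≤ q.val ∧ (π p).val < b ∧ b ≤ (π q).val then 1 else 0 := by
  rw [rankCount, rankCount, sum_eq_add_add_sum_erase hpq.ne, sum_eq_add_add_sum_erase hpq.ne]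
  have : ∀ k ∈ (Finset.univ.erase p).erase q,
      (if k.val < a ∧ ((π * Equiv.swap p q) k).val < b then 1 else 0) =
      if k.val < a ∧ (π k).val < b then 1 else 0 := by
    intro k hk
    simp only [Finset.mem_erase] at hk
    rw [Equiv.Perm.mul_apply, Equiv.swap_apply_of_ne_of_ne hk.2.1 hk.1]
  rw [Finset.sum_congr rfl this]
  have h1 : (π * Equiv.swap p q) p = π q := by simp
  have h2 : (π * Equiv.swap p q) q = π p := by simp
  rw [h1, h2]
  rw [Fin.lt_def] at hpq hπ
  split_ifs <;> omega

theorem rankLE_mul_swap {m : ℕ} (π : Equiv.Perm (Fin m)) {p q : Fin m} (hpq : p < q)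
    (hπ : π p < π q) : RankLE π (π * Equiv.swap p q) := fun a b => by
  rw [rankCount_mul_swap π hpq hπ]; omega

theorem BruhatStep.rankLE {m : ℕ} {π ρ : Equiv.Perm (Fin m)} (h : BruhatStep π ρ) :
    RankLE π ρ := by
  obtain ⟨i, j, hij, rfl, hl⟩ := h
  have key : ∀ i j : Fin m, i < j → length (Equiv.swap i j * π) = length π + 1 →
      RankLE π (Equiv.swap i j * π) := by
    intro i j hij hl
    have e : Equiv.swap i j * π = π * Equiv.swap (π⁻¹ i) (π⁻¹ j) := by
      rw [Equiv.mul_swap_eq_swap_mul]; simp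
    have hne : π⁻¹ i ≠ π⁻¹ j := fun h => hij.ne (π⁻¹.injective h)
    rcases lt_or_gt_of_ne hne with h | h
    · rw [e]; exact rankLE_mul_swap π h (by simpa using hij)
    · exfalso
      have := length_lt_length_mul_swap (Equiv.swap i j * π) h (by simpa using hij)
      rw [e, mul_assoc, Equiv.swap_comm, Equiv.swap_mul_self, mul_one, Equiv.swap_comm, ← e] at this
      omega
  rcases lt_or_gt_of_ne hij with h | h
  · exact key i j h hl
  · rw [Equiv.swap_comm] at hl ⊢; exact key j i h hl

theorem BruhatLE.rankLE {m : ℕ} {π ρ : Equiv.Perm (Fin m)} (h : BruhatLE π ρ) : RankLE π ρ := by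
  induction h with
  | refl => exact fun a b => le_rfl
  | tail _ hs ih => exact ih.trans hs.rankLE

theorem rankCount_eq_add_sum {m : ℕ} (π : Equiv.Perm (Fin m)) (a : ℕ) {b c : ℕ} (h : b ≤ c) :
    rankCount π a c = rankCount π a b +
      ∑ k : Fin m, if k.val < a ∧ b ≤ (π k).val ∧ (π k).val < c then 1 else 0 := by
  rw [rankCount, rankCount, ← Finset.sum_add_distrib]
  refine Finset.sum_congr rfl fun k _ => ?_
  split_ifs <;> omega

/-- A permutation that is strictly below `τ` for the rank matrices has a Bruhat step towards `τ`.
At the first position `p` where the two differ, the value is exchanged with the next one that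
lies between `σ p` and `τ p`. -/
theorem exists_bruhatStep {m : ℕ} {σ τ : Equiv.Perm (Fin m)} (h : RankLE σ τ) (hne : σ ≠ τ) :
    ∃ ρ, BruhatStep σ ρ ∧ RankLE ρ τ := by
  obtain ⟨p, hp, hmin⟩ : ∃ p, σ p ≠ τ p ∧ ∀ k < p, σ k = τ k := by
    have hex : (Finset.univ.filter fun p => σ p ≠ τ p).Nonempty := by
      by_contra hcon
      rw [Finset.not_nonempty_iff_eq_empty, Finset.filter_eq_empty_iff] at hcon
      exact hne (Equiv.ext fun x => not_not.mp (hcon (Finset.mem_univ x)))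
    refine ⟨_, (Finset.mem_filter.mp (Finset.min'_mem _ hex)).2, fun k hk => ?_⟩
    by_contra hk'
    exact absurd (Finset.min'_le _ k (by simpa using hk')) (not_le.mpr hk)
  have hpτ : σ p < τ p := by
    have h1 := h (p.val + 1) ((τ p).val + 1)
    rw [rankCount_succ, rankCount_succ] at h1
    have h2 : rankCount σ p.val ((τ p).val + 1) = rankCount τ p.val ((τ p).val + 1) := by
      refine Finset.sum_congr rfl fun k _ => ?_
      by_cases hk : k < p
      · rw [hmin k hk]
      · have : ¬ k.val < p.val := hk
        simp [this]
    have h3 : (σ p).val < (τ p).val + 1 := by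
      by_contra h3
      rw [h2, if_pos (by omega), if_neg h3] at h1
      omega
    exact lt_of_le_of_ne (Fin.le_def.mpr (by omega)) hp
  obtain ⟨q, ⟨hpq, hq1, hq2⟩, hqmin⟩ : ∃ q, (p < q ∧ σ p < σ q ∧ σ q ≤ τ p) ∧
      ∀ x, p < x → x < q → ¬ (σ p < σ x ∧ σ x ≤ τ p) := by
    have hex : (Finset.univ.filter fun q => p < q ∧ σ p < σ q ∧ σ q ≤ τ p).Nonempty := by
      refine ⟨σ⁻¹ (τ p), ?_⟩
      have hgt : p < σ⁻¹ (τ p) := by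
        rcases lt_trichotomy p (σ⁻¹ (τ p)) with h' | h' | h'
        · exact h'
        · exact absurd ((congrArg σ h').trans (by simp)) hp
        · have := (hmin _ h').symm.trans (show σ (σ⁻¹ (τ p)) = τ p by simp)
          exact absurd (τ.injective this) h'.ne
      exact Finset.mem_filter.mpr ⟨Finset.mem_univ _, hgt, by simpa using hpτ, by simp⟩
    refine ⟨_, (Finset.mem_filter.mp (Finset.min'_mem _ hex)).2, fun x hx1 hx2 hx => ?_⟩
    exact absurd (Finset.min'_le _ x (by simpa using ⟨hx1, hx⟩)) (not_le.mpr hx2)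
  refine ⟨σ * Equiv.swap p q, ⟨σ p, σ q, hq1.ne, Equiv.mul_swap_eq_swap_mul .., ?_⟩, ?_⟩
  · refine length_mul_swap_of_forall σ hpq hq1 fun x h1 h2 h3 => ?_
    by_contra h4
    exact hqmin x h1 h2 ⟨h3, ((not_le.mp h4).trans_le hq2).le⟩
  · intro a b
    have e := rankCount_mul_swap σ hpq hq1 a b
    split_ifs at e with hab
    · obtain ⟨ha1, ha2, hb1, hb2⟩ := hab
      -- compare the numbers of values in `[b, τ p]` at the positions before `a`
      have hbc : b ≤ (τ p).val + 1 := by rw [Fin.le_def] at hq2; omega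
      have e1 := rankCount_eq_add_sum σ a hbc
      have e2 := rankCount_eq_add_sum τ a hbc
      have e3 := h a ((τ p).val + 1)
      have e4 : (∑ k : Fin m, if k.val < a ∧ b ≤ (σ k).val ∧ (σ k).val < (τ p).val + 1
            then 1 else 0) <
          ∑ k : Fin m, if k.val < a ∧ b ≤ (τ k).val ∧ (τ k).val < (τ p).val + 1
            then 1 else 0 := by
        refine Finset.sum_lt_sum (fun k _ => ?_) ⟨p, Finset.mem_univ _, ?_⟩
        · rcases lt_trichotomy k p with hk | rfl | hk
          · rw [hmin k hk]
          · rw [if_neg (by omega)]; omega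
          · rw [if_neg]
            · omega
            · rintro ⟨h1, h2, h3⟩
              exact hqmin k hk (Fin.lt_def.mpr (by omega))
                ⟨Fin.lt_def.mpr (by omega), Fin.le_def.mpr (by omega)⟩
        · rw [if_neg (by omega), if_pos]
          · omega
          · rw [Fin.le_def] at hq2; omega
      omega
    · rw [add_zero] at e; rw [← e]; exact h a b

theorem length_le {m : ℕ} (π : Equiv.Perm (Fin m)) : length π ≤ m * m := by
  simpa [length] using Finset.card_le_univ (inversions π)

theorem bruhatLE_iff_rankLE {m : ℕ} {σ τ : Equiv.Perm (Fin m)} : BruhatLE σ τ ↔ RankLE σ τ := by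
  refine ⟨BruhatLE.rankLE, fun h => ?_⟩
  induction hd : m * m - length σ generalizing σ with
  | zero =>
    by_contra hcon
    obtain ⟨ρ, ⟨_, _, _, _, hl⟩, _⟩ := exists_bruhatStep h fun e => hcon (e ▸ .refl)
    have := length_le ρ
    omega
  | succ d ih =>
    by_cases hne : σ = τ
    · exact hne ▸ .refl
    · obtain ⟨ρ, hs, hρ⟩ := exists_bruhatStep h hne
      refine .head hs (ih hρ ?_)
      obtain ⟨_, _, _, _, hl⟩ := hs
      omega

/-! ### Lifting along adjacent transpositions -/

theorem rankCount_mul_swap_of_ne {m : ℕ} (π : Equiv.Perm (Fin m)) {p q : Fin m}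
    (hpq : q.val = p.val + 1) {a : ℕ} (ha : a ≠ p.val + 1) (b : ℕ) :
    rankCount (π * Equiv.swap p q) a b = rankCount π a b := by
  have hlt : p < q := Fin.lt_def.mpr (by omega)
  rcases lt_or_gt_of_ne fun h => hlt.ne (π.injective h) with h | h
  · rw [rankCount_mul_swap π hlt h, if_neg (by omega), add_zero]
  · have := rankCount_mul_swap (π * Equiv.swap p q) hlt (by simpa using h) a b
    rwa [if_neg (by omega), mul_assoc, Equiv.swap_mul_self, mul_one, add_zero] at this

theorem rankCount_mul_swap_succ {m : ℕ} (π : Equiv.Perm (Fin m)) {p q : Fin m}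
    (hpq : q.val = p.val + 1) (b : ℕ) :
    rankCount (π * Equiv.swap p q) (p.val + 1) b =
      rankCount π p.val b + if (π q).val < b then 1 else 0 := by
  rw [rankCount_succ, rankCount_mul_swap_of_ne π hpq (by omega)]
  simp

theorem rankCount_succ_succ {m : ℕ} (π : Equiv.Perm (Fin m)) {p q : Fin m}
    (hpq : q.val = p.val + 1) (b : ℕ) :
    rankCount π (p.val + 2) b = rankCount π p.val b + (if (π p).val < b then 1 else 0) +
      if (π q).val < b then 1 else 0 := by
  rw [← rankCount_succ, ← hpq, ← rankCount_succ, hpq]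

theorem RankLE.mul_swap_le {m : ℕ} {σ τ : Equiv.Perm (Fin m)} {p q : Fin m}
    (hpq : q.val = p.val + 1) (h : RankLE σ τ) (hτ : τ q < τ p) :
    RankLE (σ * Equiv.swap p q) τ := by
  intro a b
  by_cases ha : a = p.val + 1
  · subst ha
    have h0 := h p.val b
    have h1 := h (p.val + 1) b
    have h2 := h (p.val + 2) b
    rw [rankCount_succ, rankCount_succ] at h1
    rw [rankCount_succ_succ _ hpq, rankCount_succ_succ _ hpq] at h2
    rw [rankCount_mul_swap_succ σ hpq, rankCount_succ]
    rw [Fin.lt_def] at hτ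
    split_ifs at * <;> omega
  · rw [rankCount_mul_swap_of_ne σ hpq ha]; exact h a b

theorem RankLE.mul_swap_mul_swap {m : ℕ} {σ τ : Equiv.Perm (Fin m)} {p q : Fin m}
    (hpq : q.val = p.val + 1) (h : RankLE σ τ) (hσ : σ q < σ p) :
    RankLE (σ * Equiv.swap p q) (τ * Equiv.swap p q) := by
  intro a b
  by_cases ha : a = p.val + 1
  · subst ha
    have h0 := h p.val b
    have h2 := h (p.val + 2) b
    rw [rankCount_succ_succ _ hpq, rankCount_succ_succ _ hpq] at h2
    rw [rankCount_mul_swap_succ σ hpq, rankCount_mul_swap_succ τ hpq]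
    rw [Fin.lt_def] at hσ
    split_ifs at * <;> omega
  · rw [rankCount_mul_swap_of_ne σ hpq ha, rankCount_mul_swap_of_ne τ hpq ha]; exact h a b

/-- An adjacent transposition preserves the order of every other pair of points. -/
theorem swap_lt_swap {m : ℕ} {p q x y : Fin m} (hpq : q.val = p.val + 1) (h : x < y)
    (hne : ¬ (x = p ∧ y = q)) : Equiv.swap p q x < Equiv.swap p q y := by
  simp only [Equiv.swap_apply_def]
  simp only [Fin.ext_iff, Fin.lt_def] at *
  split_ifs <;> omega

theorem RankLE.conj_le {m : ℕ} {σ τ : Equiv.Perm (Fin m)} {p q : Fin m}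
    (hpq : q.val = p.val + 1) (h : RankLE σ τ) (hτ : τ q < τ p) (hinv : τ⁻¹ = τ) :
    RankLE (Equiv.swap p q * σ * Equiv.swap p q) τ := by
  have h1 := ((h.mul_swap_le hpq hτ).inv)
  rw [hinv] at h1
  have h2 := (h1.mul_swap_le hpq hτ).inv
  rw [hinv] at h2
  simpa [mul_assoc] using h2

theorem RankLE.conj_conj {m : ℕ} {σ τ : Equiv.Perm (Fin m)} {p q : Fin m}
    (hpq : q.val = p.val + 1) (h : RankLE σ τ) (hσ : σ q < σ p) (hσ' : σ p ≠ q)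
    (hσi : σ⁻¹ = σ) (hτi : τ⁻¹ = τ) :
    RankLE (Equiv.swap p q * σ * Equiv.swap p q) (Equiv.swap p q * τ * Equiv.swap p q) := by
  have h1 := (h.mul_swap_mul_swap hpq hσ).inv
  rw [mul_inv_rev, mul_inv_rev, hσi, hτi, Equiv.swap_inv] at h1
  exact h1.mul_swap_mul_swap hpq (swap_lt_swap hpq hσ fun e => hσ' e.2)

theorem length_conj {m : ℕ} {τ : Equiv.Perm (Fin m)} {p q : Fin m} (hpq : q.val = p.val + 1)
    (h : τ p < τ q) (hp : τ p ≠ p) (hττ : ∀ x, τ (τ x) = x) :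
    length (Equiv.swap p q * τ * Equiv.swap p q) = length τ + 2 := by
  have hlt : p < q := Fin.lt_def.mpr (by omega)
  have h1 : length (τ * Equiv.swap p q) = length τ + 1 := by
    refine length_mul_swap_of_forall τ hlt h fun x hx1 hx2 => ?_
    rw [Fin.lt_def] at hx1 hx2; omega
  have e : Equiv.swap p q * τ * Equiv.swap p q = (τ * Equiv.swap p q) *
      Equiv.swap (Equiv.swap p q (τ p)) (Equiv.swap p q (τ q)) := by
    rw [Equiv.mul_swap_eq_swap_mul (τ * Equiv.swap p q)]
    simp [hττ, mul_assoc]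
  rw [e, length_mul_swap_of_forall _ (swap_lt_swap hpq h fun e => hp e.1), h1]
  · simpa [hττ] using hlt
  · intro x _ _
    simp only [Equiv.Perm.mul_apply, Equiv.swap_apply_self, hττ]
    rw [Fin.lt_def, Fin.le_def]
    omega

/-! ### Fixed-point-free involutions -/

theorem rankCount_comm {m : ℕ} {τ : Equiv.Perm (Fin m)} (hinv : τ⁻¹ = τ) (a b : ℕ) :
    rankCount τ a b = rankCount τ b a := by
  conv_lhs => rw [← hinv]
  exact rankCount_inv τ a b

/-- The points below `a` that a fixed-point-free involution maps below `a` come in pairs. -/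
theorem even_rankCount_self {m : ℕ} {τ : Equiv.Perm (Fin m)} (hττ : ∀ x, τ (τ x) = x)
    (hfix : ∀ x, τ x ≠ x) (a : ℕ) : Even (rankCount τ a a) := by
  rw [← ZMod.natCast_eq_zero_iff_even, rankCount, ← Finset.card_filter, Finset.cast_card]
  refine Finset.sum_involution (fun x _ => τ x) (fun _ _ => by decide) (fun x _ _ => hfix x)
    (fun x hx => ?_) (fun x _ => hττ x)
  simp only [Finset.mem_filter, Finset.mem_univ, true_and] at hx ⊢
  rw [hττ]
  exact hx.symm

/-- If `(p q)` is a cycle of `σ` but not of `τ`, then `σ ≤ τ` implies that `σ` is also below the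
conjugate of `τ`. The rank matrices differ in row and column `p + 1`
only; the inequality for the diagonal entry holds because both entries are even. -/
theorem RankLE.le_conj {m : ℕ} {σ τ : Equiv.Perm (Fin m)} {p q : Fin m}
    (hpq : q.val = p.val + 1) (h : RankLE σ τ) (hσp : σ p = q) (hτp : τ p ≠ q)
    (hσσ : ∀ x, σ (σ x) = x) (hσf : ∀ x, σ x ≠ x)
    (hττ : ∀ x, τ (τ x) = x) (hτf : ∀ x, τ x ≠ x) :
    RankLE σ (Equiv.swap p q * τ * Equiv.swap p q) := by
  have hσi : σ⁻¹ = σ := inv_eq_of_mul_eq_one_left (Equiv.ext hσσ)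
  have hτi : τ⁻¹ = τ := inv_eq_of_mul_eq_one_left (Equiv.ext hττ)
  have hlt : p < q := Fin.lt_def.mpr (by omega)
  have hσq : σ q = p := by rw [← hσp, hσσ]
  have hr : ∀ a b, a ≠ p.val + 1 → b ≠ p.val + 1 →
      rankCount (Equiv.swap p q * τ * Equiv.swap p q) a b = rankCount τ a b := by
    intro a b ha hb
    rw [rankCount_mul_swap_of_ne _ hpq ha, ← rankCount_inv, mul_inv_rev, Equiv.swap_inv, hτi,
      rankCount_mul_swap_of_ne _ hpq hb, rankCount_comm hτi]
  generalize hρ : Equiv.swap p q * τ * Equiv.swap p q = ρ at hr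
  have hρρ : ∀ x, ρ (ρ x) = x := fun x => by simp [← hρ, hττ]
  have hρf : ∀ x, ρ x ≠ x := fun x e => hτf (Equiv.swap p q x) <| by
    rw [← hρ] at e
    simpa using congrArg (Equiv.swap p q) e
  have hρi : ρ⁻¹ = ρ := inv_eq_of_mul_eq_one_left (Equiv.ext hρρ)
  have hρp : ρ p ≠ q := fun e => by
    have e' : τ q = p := by
      have := congrArg (Equiv.swap p q) e
      rw [← hρ] at this
      simpa using this
    exact hτp (by rw [← e', hττ])
  have row : ∀ b, b ≠ p.val + 1 → rankCount ρ (p.val + 1) b ≤ rankCount σ (p.val + 1) b := by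
    intro b hb
    have h0 := h p.val b
    have h2 := h (p.val + 2) b
    rw [← hr p.val b (by omega) hb] at h0
    rw [← hr (p.val + 2) b (by omega) hb, rankCount_succ_succ _ hpq,
      rankCount_succ_succ _ hpq, hσp, hσq] at h2
    rw [rankCount_succ, rankCount_succ, hσp]
    split_ifs at * <;> omega
  intro a b
  by_cases ha : a = p.val + 1
  · subst ha
    by_cases hb : b = p.val + 1
    · subst hb
      have e1 : ∀ π : Equiv.Perm (Fin m), π⁻¹ = π → rankCount π (p.val + 1) (p.val + 1) =
          rankCount π p.val p.val + (if (π p).val < p.val then 1 else 0) +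
            if (π p).val < p.val + 1 then 1 else 0 := by
        intro π hπ
        rw [rankCount_succ, rankCount_comm hπ, rankCount_succ]
      have h0 := h p.val p.val
      have h2 := h (p.val + 2) p.val
      have evσ := even_rankCount_self hσσ hσf p.val
      have evρ := even_rankCount_self hρρ hρf p.val
      rw [← hr _ _ (by omega) (by omega)] at h0 h2
      rw [rankCount_succ_succ _ hpq, rankCount_succ_succ _ hpq, hσp, hσq] at h2
      rw [e1 ρ hρi, e1 σ hσi, hσp]
      have hρp' : (ρ p).val ≠ p.val := fun e => hρf p (Fin.ext e)
      rw [Nat.even_iff] at evσ evρ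
      split_ifs at * <;> omega
    · exact row b hb
  · by_cases hb : b = p.val + 1
    · subst hb
      rw [rankCount_comm hρi, rankCount_comm hσi]
      exact row a ha
    · rw [hr a b ha hb]; exact h a b

namespace FPFInvolution

variable {n : ℕ}

theorem le_iff_rankLE {σ τ : FPFInvolution n} : σ ≤ τ ↔ RankLE σ.1 τ.1 := bruhatLE_iff_rankLE

theorem apply_apply (τ : FPFInvolution n) (x : Fin (2 * n)) : τ.1 (τ.1 x) = x :=
  Equiv.ext_iff.mp τ.2.1 x

theorem inv_eq (τ : FPFInvolution n) : τ.1⁻¹ = τ.1 := inv_eq_of_mul_eq_one_left τ.2.1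

theorem length_lt {σ τ : FPFInvolution n} (h : σ < τ) : length σ.1 < length τ.1 := by
  rcases BruhatLE.eq_or_length_lt h.le with e | e
  · exact absurd (Subtype.ext e) h.ne
  · exact e

theorem eq_of_le_of_length_le {σ τ : FPFInvolution n} (h : σ ≤ τ)
    (hl : length τ.1 ≤ length σ.1) : σ = τ := by
  rcases BruhatLE.eq_or_length_lt h with e | e
  · exact Subtype.ext e
  · omega

theorem lt_of_le_of_length_lt {σ τ : FPFInvolution n} (h : σ ≤ τ)
    (hl : length σ.1 < length τ.1) : σ < τ :=
  lt_of_le_of_ne h fun e => by rw [e] at hl; omega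

/-- The conjugate of a fixed-point-free involution by a transposition. -/
def conj (τ : FPFInvolution n) (p q : Fin (2 * n)) : FPFInvolution n :=
  ⟨Equiv.swap p q * τ.1 * Equiv.swap p q, Equiv.ext fun x => by simp [τ.apply_apply],
    fun x e => τ.2.2 (Equiv.swap p q x) <| by simpa using congrArg (Equiv.swap p q) e⟩

theorem conj_conj (τ : FPFInvolution n) (p q : Fin (2 * n)) : (τ.conj p q).conj p q = τ :=
  Subtype.ext <| Equiv.ext fun x => by simp [conj]

section

variable {σ τ : FPFInvolution n} {p q : Fin (2 * n)}

theorem length_conj (hpq : q.val = p.val + 1) (h : τ.1 p < τ.1 q) :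
    length (τ.conj p q).1 = length τ.1 + 2 :=
  BruhatMotzkin.length_conj hpq h (τ.2.2 p) τ.apply_apply

theorem conj_le (hpq : q.val = p.val + 1) (h : σ ≤ τ) (hτ : τ.1 q < τ.1 p) :
    σ.conj p q ≤ τ :=
  le_iff_rankLE.mpr ((le_iff_rankLE.mp h).conj_le hpq hτ τ.inv_eq)

theorem conj_apply_lt (hpq : q.val = p.val + 1) (hτ : τ.1 q < τ.1 p) (hp : τ.1 p ≠ q) :
    (τ.conj p q).1 p < (τ.conj p q).1 q := by
  simpa [conj] using swap_lt_swap hpq hτ fun e => hp e.2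

theorem conj_apply_gt (hpq : q.val = p.val + 1) (hτ : τ.1 p < τ.1 q) :
    (τ.conj p q).1 q < (τ.conj p q).1 p := by
  simpa [conj] using swap_lt_swap hpq hτ fun e => τ.2.2 p e.1

theorem length_conj_of_gt (hpq : q.val = p.val + 1) (hτ : τ.1 q < τ.1 p) (hp : τ.1 p ≠ q) :
    length (τ.conj p q).1 + 2 = length τ.1 := by
  rw [← length_conj hpq (conj_apply_lt hpq hτ hp), conj_conj]

end

/-- All descents of `τ` at adjacent positions `p, q` come from a cycle `(p q)`. -/
def OnlyTrivialDescents (τ : FPFInvolution n) : Prop :=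
  ∀ p q : Fin (2 * n), q.val = p.val + 1 → τ.1 q < τ.1 p → τ.1 p = q

/-- An involution with only trivial descents is `(0 1)(2 3)(4 5)⋯`. -/
theorem OnlyTrivialDescents.apply_eq {τ : FPFInvolution n} (h : τ.OnlyTrivialDescents) (k : ℕ)
    (hk : 2 * k + 1 < 2 * n) : τ.1 ⟨2 * k, by omega⟩ = ⟨2 * k + 1, hk⟩ := by
  induction k using Nat.strong_induction_on with
  | _ k ih =>
    -- no later point is mapped below `2 * k`
    have hge : ∀ x : Fin (2 * n), 2 * k ≤ x.val → 2 * k ≤ (τ.1 x).val := by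
      intro x hx
      by_contra hcon
      obtain ⟨j, hj | hj⟩ := Nat.even_or_odd' (τ.1 x).val
      · have h1 := ih j (by omega) (by omega)
        have h2 : (⟨2 * j, by omega⟩ : Fin (2 * n)) = τ.1 x := Fin.ext hj.symm
        rw [h2, τ.apply_apply] at h1
        have := congrArg Fin.val h1
        simp only at this
        omega
      · have h1 := congrArg τ.1 (ih j (by omega) (by omega))
        have h2 : (⟨2 * j + 1, by omega⟩ : Fin (2 * n)) = τ.1 x := Fin.ext hj.symm
        rw [h2, τ.apply_apply, τ.apply_apply] at h1
        have := congrArg Fin.val h1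
        simp only at this
        omega
    set z : Fin (2 * n) := ⟨2 * k, by omega⟩ with hz
    have h1 : 2 * k ≤ (τ.1 z).val := hge z le_rfl
    have h2 : (τ.1 z).val ≠ 2 * k := fun e => τ.2.2 z (Fin.ext e)
    by_contra hcon
    have h3 : (τ.1 z).val ≠ 2 * k + 1 := fun e => hcon (Fin.ext e)
    have hlt := (τ.1 z).isLt
    -- otherwise there is a nontrivial descent just before the partner of `2 * k`
    set p : Fin (2 * n) := ⟨(τ.1 z).val - 1, by omega⟩ with hp
    have h4 : 2 * k ≤ (τ.1 p).val := hge p (by simp only [hp]; omega)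
    have h5 : τ.1 p ≠ z := fun e => by
      have := congrArg τ.1 e
      rw [τ.apply_apply] at this
      have := congrArg Fin.val this
      simp only [hp] at this
      omega
    have h6 : (τ.1 p).val ≠ 2 * k := fun e => h5 (Fin.ext e)
    have h7 := h p (τ.1 z) (by simp only [hp]; omega) (by
      rw [τ.apply_apply, Fin.lt_def]
      simp only [hz]
      omega)
    have h8 : (τ.1 z).val - 1 = 2 * k := congrArg Fin.val (τ.1.injective h7)
    omega

theorem OnlyTrivialDescents.eq {σ τ : FPFInvolution n} (hσ : σ.OnlyTrivialDescents)
    (hτ : τ.OnlyTrivialDescents) : σ = τ := by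
  refine Subtype.ext (Equiv.ext fun x => ?_)
  obtain ⟨j, hj | hj⟩ := Nat.even_or_odd' x.val
  · have e : x = ⟨2 * j, by omega⟩ := Fin.ext hj
    rw [e, hσ.apply_eq j (by omega), hτ.apply_eq j (by omega)]
  · have e : x = ⟨2 * j + 1, by omega⟩ := Fin.ext hj
    have h1 := hσ.apply_eq j (by omega)
    have h2 := hτ.apply_eq j (by omega)
    rw [e]
    conv_lhs => rw [← h1]
    conv_rhs => rw [← h2]
    rw [σ.apply_apply, τ.apply_apply]

theorem exists_onlyTrivialDescents_le (τ : FPFInvolution n) :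
    ∃ β : FPFInvolution n, β ≤ τ ∧ β.OnlyTrivialDescents := by
  induction hl : length τ.1 using Nat.strong_induction_on generalizing τ with
  | _ l ih =>
    by_cases h : τ.OnlyTrivialDescents
    · exact ⟨τ, le_rfl, h⟩
    · simp only [OnlyTrivialDescents, not_forall] at h
      obtain ⟨p, q, hpq, hτ, hp⟩ := h
      have := length_conj_of_gt hpq hτ hp
      obtain ⟨β, hβ, hβ'⟩ := ih _ (by omega) (τ.conj p q) rfl
      exact ⟨β, hβ.trans (conj_le hpq le_rfl hτ), hβ'⟩

theorem OnlyTrivialDescents.le {β : FPFInvolution n} (h : β.OnlyTrivialDescents)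
    (τ : FPFInvolution n) : β ≤ τ := by
  obtain ⟨β', hβ, hβ'⟩ := exists_onlyTrivialDescents_le τ
  exact h.eq hβ' ▸ hβ

/-- Below any `τ` and above any `σ < τ` there is an involution whose length exceeds that of `σ` by
two. Induction on `τ`, comparing `σ` with the conjugate of `τ` at a nontrivial descent. -/
theorem exists_lt_le_length_eq {σ τ : FPFInvolution n} (h : σ < τ) :
    ∃ ρ : FPFInvolution n, σ < ρ ∧ ρ ≤ τ ∧ length ρ.1 = length σ.1 + 2 := by
  induction hl : length τ.1 using Nat.strong_induction_on generalizing σ τ with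
  | _ l ih =>
    have hd : ¬ τ.OnlyTrivialDescents := fun hd => absurd (hd.le σ) (not_le_of_gt h)
    simp only [OnlyTrivialDescents, not_forall] at hd
    obtain ⟨p, q, hpq, hτ, hp⟩ := hd
    have hlτ := length_conj_of_gt hpq hτ hp
    have hτ'τ : τ.conj p q ≤ τ := conj_le hpq le_rfl hτ
    have hτ' := conj_apply_lt hpq hτ hp
    have hne : p ≠ q := fun e => by rw [e] at hpq; omega
    have below : σ.1 q < σ.1 p → σ ≤ τ.conj p q →
        ∃ ρ : FPFInvolution n, σ < ρ ∧ ρ ≤ τ ∧ length ρ.1 = length σ.1 + 2 := by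
      intro hσ hle
      have hlt : σ < τ.conj p q := lt_of_le_of_ne hle fun e => by
        rw [← e] at hτ'; exact absurd hσ hτ'.not_gt
      obtain ⟨ρ, h1, h2, h3⟩ := ih _ (by omega) hlt rfl
      exact ⟨ρ, h1, h2.trans hτ'τ, h3⟩
    rcases lt_or_gt_of_ne fun e => hne (σ.1.injective e) with hσ | hσ
    · -- `σ` has an ascent, so that its conjugate will do
      have hlσ := length_conj hpq hσ
      refine ⟨σ.conj p q, lt_of_le_of_length_lt ?_ (by omega), conj_le hpq h.le hτ, hlσ⟩
      have := conj_le hpq (le_refl (σ.conj p q)) (conj_apply_gt hpq hσ)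
      rwa [conj_conj] at this
    by_cases hσp : σ.1 p = q
    · exact below hσ (le_iff_rankLE.mpr ((le_iff_rankLE.mp h.le).le_conj hpq hσp hp
        σ.apply_apply σ.2.2 τ.apply_apply τ.2.2))
    · -- both have a nontrivial descent, and the conjugates are compared first
      have hlσ := length_conj_of_gt hpq hσ hσp
      have hle : σ.conj p q ≤ τ.conj p q :=
        le_iff_rankLE.mpr ((le_iff_rankLE.mp h.le).conj_conj hpq hσ hσp σ.inv_eq τ.inv_eq)
      have hlt : σ.conj p q < τ.conj p q := lt_of_le_of_length_lt hle (by
        have := length_lt h; omega)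
      obtain ⟨ρ, h1, h2, h3⟩ := ih _ (by omega) hlt rfl
      rcases lt_or_gt_of_ne fun e => hne (ρ.1.injective e) with hρ | hρ
      · have hlρ := length_conj hpq hρ
        have hρ' := conj_apply_gt hpq hρ
        have h4 : ρ ≤ ρ.conj p q := by
          have := conj_le hpq (le_refl (ρ.conj p q)) hρ'
          rwa [conj_conj] at this
        have h5 : σ ≤ ρ.conj p q := by
          have := conj_le hpq (h1.le.trans h4) hρ'
          rwa [conj_conj] at this
        exact ⟨ρ.conj p q, lt_of_le_of_length_lt h5 (by omega),
          conj_le hpq (h2.trans hτ'τ) hτ, by omega⟩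
      · have h4 := conj_le hpq h1.le hρ
        rw [conj_conj] at h4
        have h5 : σ = ρ := eq_of_le_of_length_le h4 (by omega)
        exact below hσ (h5 ▸ h2)

theorem length_eq_of_covBy {σ τ : FPFInvolution n} (h : σ ⋖ τ) :
    length τ.1 = length σ.1 + 2 := by
  obtain ⟨ρ, h1, h2, h3⟩ := exists_lt_le_length_eq h.lt
  rcases h2.eq_or_lt with e | e
  · rw [← e, h3]
  · exact absurd e (h.2 h1)

theorem covBy_of_length_eq {σ τ : FPFInvolution n} (h : σ ≤ τ)
    (hl : length τ.1 = length σ.1 + 2) : σ ⋖ τ := by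
  refine ⟨lt_of_le_of_length_lt h (by omega), fun ρ h1 h2 => ?_⟩
  obtain ⟨ρ', h3, h4, h5⟩ := exists_lt_le_length_eq h1
  have := length_lt (h4.trans_lt h2)
  omega

theorem onlyTrivialDescents_of_isMin {τ : FPFInvolution n} (h : IsMin τ) :
    τ.OnlyTrivialDescents := by
  obtain ⟨β, hβ, hβ'⟩ := exists_onlyTrivialDescents_le τ
  exact le_antisymm hβ (h hβ) ▸ hβ'

end FPFInvolution

namespace FPFInvolution

variable {n : ℕ}

/-! ### Inserting a pair of points -/

/-- The map on `2 * n + 2` points that exchanges `0` and `k + 1` and acts on the other points,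
relabeled in increasing order, as `τ`. -/
def insertPairFun (k : Fin (2 * n + 1)) (τ : Fin (2 * n) → Fin (2 * n)) :
    Fin (2 * n + 2) → Fin (2 * n + 2) :=
  Fin.cons k.succ (Fin.insertNth k 0 fun z => (k.succAbove (τ z)).succ)

section

variable (k : Fin (2 * n + 1)) (τ : Fin (2 * n) → Fin (2 * n))

@[simp] theorem insertPairFun_zero : insertPairFun k τ 0 = k.succ := rfl

@[simp] theorem insertPairFun_succ : insertPairFun k τ k.succ = 0 := by
  simp [insertPairFun]

@[simp] theorem insertPairFun_succAbove (z : Fin (2 * n)) :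
    insertPairFun k τ (k.succAbove z).succ = (k.succAbove (τ z)).succ := by
  simp [insertPairFun]

end

theorem forall_fin_insertPair (k : Fin (2 * n + 1)) {P : Fin (2 * n + 2) → Prop} :
    (∀ x, P x) ↔ P 0 ∧ P k.succ ∧ ∀ z : Fin (2 * n), P (k.succAbove z).succ := by
  rw [Fin.forall_fin_succ, Fin.forall_iff_succAbove k]

/-- The fixed-point-free involution obtained from `τ` by inserting the cycle `(0 k+1)`. -/
def insertPair (k : Fin (2 * n + 1)) (τ : FPFInvolution n) : FPFInvolution (n + 1) :=
  ⟨(show Function.Involutive (insertPairFun k τ.1) from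
      (forall_fin_insertPair k).mpr (by simp [τ.apply_apply])).toPerm,
    Equiv.ext ((forall_fin_insertPair k).mpr (by simp [τ.apply_apply])),
    (forall_fin_insertPair k).mpr (by simp [τ.2.2, Fin.succ_ne_zero, (Fin.succ_ne_zero _).symm])⟩

theorem insertPair_apply (k : Fin (2 * n + 1)) (τ : FPFInvolution n) (x : Fin (2 * n + 2)) :
    (insertPair k τ).1 x = insertPairFun k τ.1 x := rfl

theorem insertPair_bijective : Function.Bijective
    fun x : Fin (2 * n + 1) × FPFInvolution n => insertPair x.1 x.2 := by
  constructor
  · rintro ⟨k, σ⟩ ⟨k', τ⟩ h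
    have happ : ∀ x, insertPairFun k σ.1 x = insertPairFun k' τ.1 x := fun x =>
      Equiv.ext_iff.mp (congrArg Subtype.val h) x
    obtain rfl : k = k' := Fin.succ_injective _ (happ 0)
    have : σ = τ := Subtype.ext <| Equiv.ext fun z => by
      simpa using happ (k.succAbove z).succ
    rw [this]
  · intro τ
    have h0 : τ.1 (0 : Fin (2 * n + 2)) ≠ (0 : Fin (2 * n + 2)) := τ.2.2 _
    obtain ⟨k, hk⟩ := Fin.exists_succ_eq.mpr h0
    have hk' : τ.1 k.succ = (0 : Fin (2 * n + 2)) := by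
      rw [hk]; exact τ.apply_apply _
    have hex : ∀ z : Fin (2 * n), ∃ w : Fin (2 * n),
        (k.succAbove w).succ = τ.1 (k.succAbove z).succ := by
      intro z
      have h1 : τ.1 (k.succAbove z).succ ≠ (0 : Fin (2 * n + 2)) := fun e => by
        rw [← hk'] at e
        exact Fin.succAbove_ne k z (Fin.succ_injective _ (τ.1.injective e))
      obtain ⟨y, hy⟩ := Fin.exists_succ_eq.mpr h1
      have h2 : y ≠ k := fun e => by
        rw [e, hk] at hy
        exact Fin.succ_ne_zero _ (τ.1.injective hy).symm
      obtain ⟨w, hw⟩ := Fin.exists_succAbove_eq h2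
      exact ⟨w, by rw [hw, hy]⟩
    choose g hg using hex
    have hgg : Function.Involutive g := fun z => by
      have h1 := hg (g z)
      rw [hg z] at h1
      have h2 : (k.succAbove (g (g z))).succ = (k.succAbove z).succ := h1.trans (τ.apply_apply _)
      simpa using h2
    refine ⟨⟨k, ⟨hgg.toPerm, Equiv.ext hgg, fun z e => ?_⟩⟩, ?_⟩
    · have h1 := hg z
      rw [show g z = z from e] at h1
      exact τ.2.2 _ h1.symm
    · refine Subtype.ext <| Equiv.ext <| (forall_fin_insertPair k).mpr ⟨?_, ?_, fun z => ?_⟩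
      · rw [insertPair_apply, insertPairFun_zero]; exact hk
      · rw [insertPair_apply, insertPairFun_succ]; exact hk'.symm
      · rw [insertPair_apply, insertPairFun_succAbove]; exact hg z

theorem sum_succAbove_lt (k : Fin (2 * n + 1)) :
    (∑ z : Fin (2 * n), if (k.succAbove z).succ < k.succ then 1 else 0) = k.val := by
  have h : (∑ y : Fin (2 * n + 1), if y < k then 1 else 0) = k.val := by
    rw [← Finset.card_filter, show (Finset.univ.filter fun y => y < k) = Finset.Iio k by
      ext; simp, Fin.card_Iio]
  rw [Fin.sum_univ_succAbove _ k] at h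
  simpa using h

/-- Every point smaller than `k + 1` and different from `0` contributes an inversion with the
point `0` and one with the point `k + 1`. -/
theorem length_insertPair (k : Fin (2 * n + 1)) (τ : FPFInvolution n) :
    length (insertPair k τ).1 = length τ.1 + (2 * k.val + 1) := by
  have hs : ∀ f : Fin (2 * n + 2) → ℕ,
      ∑ x, f x = f 0 + (f k.succ + ∑ z : Fin (2 * n), f (k.succAbove z).succ) := fun f => by
    rw [Fin.sum_univ_succ, Fin.sum_univ_succAbove _ k]
  have h1 : ∑ z : Fin (2 * n), (if (k.succAbove (τ.1 z)).succ < k.succ then 1 else 0) = k.val := by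
    rw [Equiv.sum_comp τ.1 fun z => if (k.succAbove z).succ < k.succ then 1 else 0,
      sum_succAbove_lt]
  have h2 := sum_succAbove_lt k
  rw [length_eq_sum, length_eq_sum]
  change ∑ i : Fin (2 * n + 2), ∑ j : Fin (2 * n + 2),
    (if i < j ∧ insertPairFun k τ.1 j < insertPairFun k τ.1 i then 1 else 0) = _
  simp only [hs (fun j => if _ ∧ insertPairFun k τ.1 j < _ then 1 else 0)]
  rw [hs]
  simp only [insertPairFun_zero, insertPairFun_succ, insertPairFun_succAbove, Fin.succ_pos,
    lt_irrefl, not_lt_zero, true_and, false_and, and_false, and_true, if_true, if_false, h1,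
    Finset.sum_const_zero, Finset.sum_add_distrib, h2]
  simp only [Fin.succ_lt_succ_iff, Fin.succAbove_lt_succAbove_iff]
  ring

theorem exists_length_eq (τ : FPFInvolution n) : ∃ k, length τ.1 = n + 2 * k := by
  induction n with
  | zero => exact ⟨0, by rw [length_eq_sum]; rfl⟩
  | succ n ih =>
    obtain ⟨⟨k, σ⟩, rfl⟩ := insertPair_bijective.2 τ
    obtain ⟨j, hj⟩ := ih σ
    exact ⟨j + k.val, by rw [length_insertPair, hj]; ring⟩

theorem exists_length_eq_self (n : ℕ) : ∃ τ : FPFInvolution n, length τ.1 = n := by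
  induction n with
  | zero => exact ⟨⟨1, by simp, fun i => i.elim0⟩, by rw [length_eq_sum]; rfl⟩
  | succ n ih =>
    obtain ⟨σ, hσ⟩ := ih
    exact ⟨insertPair 0 σ, by rw [length_insertPair, hσ]; simp⟩

/-- The rank `(ℓ(τ) - n) / 2` of a fixed-point-free involution; numerator and quotient are exact. -/
def rank (τ : FPFInvolution n) : ℕ :=
  (length τ.1 - n) / 2

theorem length_eq_add_rank (τ : FPFInvolution n) : length τ.1 = n + 2 * τ.rank := by
  obtain ⟨k, hk⟩ := τ.exists_length_eq
  rw [rank]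
  omega

theorem rank_insertPair (k : Fin (2 * n + 1)) (τ : FPFInvolution n) :
    (insertPair k τ).rank = k.val + τ.rank := by
  have h1 := (insertPair k τ).length_eq_add_rank
  rw [length_insertPair, length_eq_add_rank] at h1
  omega

theorem OnlyTrivialDescents.rank_eq_zero {τ : FPFInvolution n} (h : τ.OnlyTrivialDescents) :
    τ.rank = 0 := by
  obtain ⟨β, hβ⟩ := exists_length_eq_self n
  have h1 : length τ.1 ≤ length β.1 := by
    rcases (h.le β).eq_or_lt with e | e
    · rw [e]
    · exact (length_lt e).le
  rw [length_eq_add_rank] at h1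
  omega

theorem sum_X_pow_rank (n : ℕ) :
    ∑ τ : FPFInvolution n, (X : ℤ[X]) ^ τ.rank = ∏ k ∈ Finset.Icc 1 n, qInt (2 * k - 1) := by
  induction n with
  | zero =>
    obtain ⟨τ, hτ⟩ := exists_length_eq_self 0
    have hu : ∀ σ : FPFInvolution 0, σ = τ := fun σ => Subtype.ext (Equiv.ext fun i => i.elim0)
    rw [Fintype.sum_eq_single τ fun σ hσ => absurd (hu σ) hσ]
    simp [rank, hτ]
  | succ n ih =>
    rw [← insertPair_bijective.sum_comp, Fintype.sum_prod_type]
    simp only [rank_insertPair, pow_add, ← Finset.mul_sum, ih]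
    rw [← Finset.sum_mul, Finset.prod_Icc_succ_top (by omega), mul_comm, qInt,
      Finset.sum_range fun i => (X : ℤ[X]) ^ i]
    rfl

/-! ### The rank function -/

theorem rank_strictMono : StrictMono (rank : FPFInvolution n → ℕ) := fun σ τ h => by
  have := length_lt h
  rw [length_eq_add_rank, length_eq_add_rank] at this
  omega

/-- The grading of the fixed-point-free involutions by `rank`. -/
@[reducible] def gradeMinOrder (n : ℕ) : GradeMinOrder ℕ (FPFInvolution n) where
  grade := rank
  grade_strictMono := rank_strictMono
  covBy_grade σ τ h := by
    have := length_eq_of_covBy h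
    rw [length_eq_add_rank, length_eq_add_rank] at this
    rw [Nat.covBy_iff_add_one_eq]
    omega
  isMin_grade τ h := by
    rw [(onlyTrivialDescents_of_isMin h).rank_eq_zero]
    exact isMin_bot

/-- Every element is reached from the minimum by successive covers, so there is no other grading. -/
theorem grade_eq_rank [GradeMinOrder ℕ (FPFInvolution n)] (τ : FPFInvolution n) :
    grade ℕ τ = τ.rank := by
  induction hl : length τ.1 using Nat.strong_induction_on generalizing τ with
  | _ l ih =>
    by_cases h : τ.OnlyTrivialDescents
    · have hmin : IsMin τ := fun σ _ => h.le σ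
      rw [h.rank_eq_zero]
      exact Nat.le_zero.mp (hmin.grade ℕ (Nat.zero_le _))
    · simp only [OnlyTrivialDescents, not_forall] at h
      obtain ⟨p, q, hpq, hτ, hp⟩ := h
      have h1 := length_conj_of_gt hpq hτ hp
      have h2 : τ.conj p q ⋖ τ := covBy_of_length_eq (conj_le hpq le_rfl hτ) h1.symm
      have h3 := Nat.covBy_iff_add_one_eq.mp (h2.grade ℕ)
      rw [ih _ (by omega) (τ.conj p q) rfl] at h3
      rw [length_eq_add_rank, length_eq_add_rank] at h1
      omega

end FPFInvolution

theorem rankGF_eq_prod (n : ℕ) [GradeMinOrder ℕ (FPFInvolution n)] :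
    rankGF (FPFInvolution n) = ∏ k ∈ Finset.Icc 1 n, qInt (2 * k - 1) := by
  simp only [rankGF, FPFInvolution.grade_eq_rank, FPFInvolution.sum_X_pow_rank]

/-! ### Weighted Dyck paths -/

/-- The factor of a step of the given height in the generating function of Dyck paths. Horizontal
steps get weight zero, so that sums may run over all words in the three steps. -/
noncomputable def dyckWeight : Step → ℕ → ℤ[X]
  | Step.U, a => X ^ (a - 1)
  | Step.D, a => qInt a
  | Step.L, _ => 0

/-- The weighted sum over the paths of `m` steps that start at height `h`, end at height `0`, and
never go below the axis. -/
noncomputable def dyckSum (m : ℕ) (h : ℤ) : ℤ[X] :=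
  ∑ w : Fin m → Step, if (∀ k ≤ m, 0 ≤ h + level w k) ∧ h + level w m = 0 then
    ∏ i, dyckWeight (w i) (max (h + level w i.val) (h + level w (i.val + 1))).toNat else 0

@[simp] theorem level_zero {m : ℕ} (w : Fin m → Step) : level w 0 = 0 := by
  simp [level]

@[simp] theorem level_cons {m : ℕ} (s : Step) (w : Fin m → Step) (k : ℕ) :
    level (Fin.cons s w : Fin (m + 1) → Step) (k + 1) = s.rise + level w k := by
  simp [level, Finset.sum_filter, Fin.sum_univ_succ]

theorem level_succ {m : ℕ} (w : Fin m → Step) (i : Fin m) :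
    level w (i.val + 1) = level w i.val + (w i).rise := by
  have : (Finset.univ.filter fun j : Fin m => j.val < i.val + 1) =
      insert i (Finset.univ.filter fun j : Fin m => j.val < i.val) := by
    ext j
    simp only [Finset.mem_filter, Finset.mem_univ, true_and, Finset.mem_insert, Fin.ext_iff]
    omega
  rw [level, this, Finset.sum_insert (by simp), add_comm, level]

theorem dyckSum_zero (h : ℤ) : dyckSum 0 h = if h = 0 then 1 else 0 := by
  rw [dyckSum, Fintype.sum_unique]
  simp only [nonpos_iff_eq_zero, forall_eq, level_zero, add_zero, Finset.univ_eq_empty,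
    Finset.prod_empty]
  by_cases hh : h = 0 <;> simp [hh]

/-- The recursion by the first step. At `h = 0` the down step is excluded by the factor
`qInt 0 = 0`. -/
theorem dyckSum_succ (m : ℕ) {h : ℤ} (hh : 0 ≤ h) :
    dyckSum (m + 1) h =
      X ^ h.toNat * dyckSum m (h + 1) + qInt h.toNat * dyckSum m (h - 1) := by
  have step : ∀ (s : Step) (w : Fin m → Step),
      (if (∀ k ≤ m + 1, 0 ≤ h + level (Fin.cons s w : Fin (m + 1) → Step) k) ∧
          h + level (Fin.cons s w : Fin (m + 1) → Step) (m + 1) = 0 then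
        ∏ i, dyckWeight ((Fin.cons s w : Fin (m + 1) → Step) i)
          (max (h + level (Fin.cons s w : Fin (m + 1) → Step) i.val)
            (h + level (Fin.cons s w : Fin (m + 1) → Step) (i.val + 1))).toNat else 0) =
      dyckWeight s (max h (h + s.rise)).toNat *
        if (∀ k ≤ m, 0 ≤ (h + s.rise) + level w k) ∧ (h + s.rise) + level w m = 0 then
          ∏ i, dyckWeight (w i) (max ((h + s.rise) + level w i.val)
            ((h + s.rise) + level w (i.val + 1))).toNat else 0 := by
    intro s w
    have hk : (∀ k ≤ m + 1, 0 ≤ h + level (Fin.cons s w : Fin (m + 1) → Step) k) ↔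
        ∀ k ≤ m, 0 ≤ (h + s.rise) + level w k := by
      constructor
      · intro H k hk
        have := H (k + 1) (by omega)
        rw [level_cons] at this
        omega
      · rintro H (_ | k) hk
        · simpa using hh
        · have := H k (by omega)
          rw [level_cons]
          omega
    simp only [hk, level_cons, Fin.prod_univ_succ, Fin.cons_zero, Fin.cons_succ, Fin.val_zero,
      Fin.val_succ, level_zero, add_zero, ← add_assoc, mul_ite, mul_zero]
  have hU : (Finset.univ : Finset Step) = {Step.U, Step.D, Step.L} := rfl
  have sum : dyckSum (m + 1) h = ∑ s : Step,
      dyckWeight s (max h (h + s.rise)).toNat * dyckSum m (h + s.rise) := by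
    rw [dyckSum, ← (Fin.consEquiv fun _ => Step).sum_comp, Fintype.sum_prod_type]
    refine Finset.sum_congr rfl fun s _ => ?_
    rw [dyckSum, Finset.mul_sum]
    exact Finset.sum_congr rfl fun w _ => step s w
  rw [sum, hU, Finset.sum_insert (by decide), Finset.sum_insert (by decide), Finset.sum_singleton]
  simp only [dyckWeight, zero_mul, add_zero, Step.rise]
  rw [max_eq_right (by omega), max_eq_left (by omega),
    show (h + 1).toNat - 1 = h.toNat by omega, sub_eq_add_neg]

theorem dyckSum_of_lt (m h : ℕ) (hlt : m < h) : dyckSum m h = 0 := by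
  induction m generalizing h with
  | zero => rw [dyckSum_zero, if_neg (by omega)]
  | succ m ih =>
    obtain ⟨h, rfl⟩ : ∃ h', h = h' + 1 := ⟨h - 1, by omega⟩
    have h1 := ih (h + 1 + 1) (by omega)
    have h2 := ih h (by omega)
    rw [dyckSum_succ _ (by omega)]
    push_cast at h1 ⊢
    rw [h1, add_sub_cancel_right, h2]
    simp

theorem qInt_add (a b : ℕ) : qInt (a + b) = qInt a + X ^ a * qInt b := by
  simp only [qInt, Finset.sum_range_add, pow_add, Finset.mul_sum]

/-- At `q = 1` this counts the ways to match the `h` endpoints that are open at the start with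
later points, and the other `2 * j` points among themselves. -/
theorem dyckSum_add_two_mul (h j : ℕ) :
    dyckSum (h + 2 * j) h = (∏ i ∈ Finset.range h, qInt (2 * j + 1 + i)) *
      ∏ k ∈ Finset.Icc 1 j, qInt (2 * k - 1) := by
  induction hm : h + 2 * j generalizing h j with
  | zero =>
    obtain ⟨rfl, rfl⟩ : h = 0 ∧ j = 0 := by omega
    simp [dyckSum_zero]
  | succ m ih =>
    rw [dyckSum_succ _ (by omega), Int.toNat_natCast]
    rcases h with _ | h
    · obtain ⟨j, rfl⟩ : ∃ j', j = j' + 1 := ⟨j - 1, by omega⟩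
      have := ih 1 j (by omega)
      push_cast at this ⊢
      rw [this, Finset.prod_Icc_succ_top (by omega), show 2 * (j + 1) - 1 = 2 * j + 1 by omega]
      simp [qInt, mul_comm]
    · have hd := ih h j (by omega)
      push_cast
      rw [add_sub_cancel_right, hd, Finset.prod_range_succ]
      rcases j with _ | j
      · have := dyckSum_of_lt m (h + 1 + 1) (by omega)
        push_cast at this
        rw [this, show 2 * 0 + 1 + h = h + 1 by ring]
        ring
      · have hu := ih (h + 1 + 1) j (by omega)
        push_cast at hu
        have e : ∏ i ∈ Finset.range h, qInt (2 * j + 1 + (i + 1 + 1)) =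
            ∏ i ∈ Finset.range h, qInt (2 * (j + 1) + 1 + i) :=
          Finset.prod_congr rfl fun i _ => congrArg qInt (by ring)
        rw [hu, Finset.prod_range_succ', Finset.prod_range_succ', e,
          Finset.prod_Icc_succ_top (by omega),
          show 2 * (j + 1) + 1 + h = h + 1 + (2 * j + 2) by ring, qInt_add (h + 1),
          show 2 * (j + 1) - 1 = 2 * j + 1 by omega]
        ring_nf

/-! ### The generating functions of a Dyck path -/

section

variable {n : ℕ} {w : Fin (2 * n) → Step}

theorem mem_dyckPaths : w ∈ dyckPaths n ↔ IsMotzkin w ∧ ∀ i, w i ≠ Step.L := by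
  simp [dyckPaths, motzkinPaths]

theorem card_filter_up_eq (hw : w ∈ dyckPaths n) :
    (Finset.univ.filter fun i => w i = Step.U).card = n := by
  obtain ⟨⟨_, hend⟩, hL⟩ := mem_dyckPaths.mp hw
  have h1 : level w (2 * n) = ∑ i, (2 * (if w i = Step.U then 1 else 0) - 1 : ℤ) := by
    rw [level, Finset.filter_true_of_mem fun i _ => i.isLt]
    refine Finset.sum_congr rfl fun i _ => ?_
    have := hL i
    revert this
    cases w i <;> simp [Step.rise]
  rw [hend, Finset.sum_sub_distrib, ← Finset.mul_sum, ← Finset.natCast_card_filter] at h1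
  simp only [Finset.sum_const, Finset.card_univ, Fintype.card_fin, nsmul_eq_mul, mul_one] at h1
  push_cast at h1
  omega

theorem one_le_height_of_up (hw : w ∈ dyckPaths n) {i : Fin (2 * n)} (hi : w i = Step.U) :
    1 ≤ height w i := by
  have h1 := (mem_dyckPaths.mp hw).1.1 i.val i.isLt.le
  have h2 := level_succ w i
  rw [hi, Step.rise] at h2
  rw [height]
  omega

theorem sum_Icc_X_pow_sub_one (a : ℕ) : ∑ l ∈ Finset.Icc 1 a, (X : ℤ[X]) ^ (l - 1) = qInt a := by
  rw [← Finset.Ico_add_one_right_eq_Icc, Finset.sum_Ico_eq_sum_range, qInt]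
  simp

theorem pathGF_eq (hw : w ∈ dyckPaths n) : pathGF w = X ^ n * pathGFTilde w := by
  have h1 : pathGF w = ∏ i, ∑ l ∈ if w i = Step.D then Finset.Icc 1 (height w i) else {0},
      (X : ℤ[X]) ^ (if w i = Step.D then l - 1 else height w i) := by
    rw [Finset.prod_univ_sum, pathGF, labelings]
    exact Finset.sum_congr rfl fun l _ => (Finset.prod_pow_eq_pow_sum _ _ _).symm
  have h2 : (X : ℤ[X]) ^ n = ∏ i, if w i = Step.U then X else 1 := by
    rw [Finset.prod_ite, Finset.prod_const, Finset.prod_const_one, mul_one, card_filter_up_eq hw]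
  rw [h1, h2, pathGFTilde, ← Finset.prod_mul_distrib]
  refine Finset.prod_congr rfl fun i _ => ?_
  cases hi : w i with
  | U =>
    have := one_le_height_of_up hw hi
    simp [← pow_succ', Nat.sub_add_cancel this]
  | D => simp [sum_Icc_X_pow_sub_one]
  | L => exact absurd hi ((mem_dyckPaths.mp hw).2 i)

end

theorem sum_pathGFTilde_eq_dyckSum (n : ℕ) :
    ∑ δ ∈ dyckPaths n, pathGFTilde δ = dyckSum (2 * n) 0 := by
  rw [dyckSum, dyckPaths, motzkinPaths, Finset.filter_filter, Finset.sum_filter]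
  refine Finset.sum_congr rfl fun w _ => ?_
  simp only [zero_add]
  by_cases hL : ∀ i, w i ≠ Step.L
  · simp only [IsMotzkin, hL, implies_true, and_true, ne_eq, not_false_eq_true]
    refine if_congr Iff.rfl (Finset.prod_congr rfl fun i _ => ?_) rfl
    have := hL i
    rw [← height]
    revert this
    cases w i <;> simp [dyckWeight]
  · rw [if_neg fun h => hL h.2]
    push Not at hL
    obtain ⟨i, hi⟩ := hL
    rw [Finset.prod_eq_zero (Finset.mem_univ i) (by rw [hi, dyckWeight]), ite_self]

theorem sum_pathGFTilde_eq_prod (n : ℕ) :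
    ∑ δ ∈ dyckPaths n, pathGFTilde δ = ∏ k ∈ Finset.Icc 1 n, qInt (2 * k - 1) := by
  have := dyckSum_add_two_mul 0 n
  rw [sum_pathGFTilde_eq_dyckSum]
  simpa using this

end BruhatMotzkin

open Polynomial BruhatMotzkin in
theorem corollary1p2 (n : ℕ) :
    -- Bruhat order on the fixed-point-free involutions is graded
    Nonempty (GradeMinOrder ℕ (FPFInvolution n)) ∧
    -- and with its (unique) rank function
    ∀ _ : GradeMinOrder ℕ (FPFInvolution n),
      -- the two equalities of the main identity
      (∑ δ ∈ dyckPaths n, pathGF δ = X ^ n * rankGF (FPFInvolution n) ∧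
        X ^ n * rankGF (FPFInvolution n) = X ^ n * ∏ k ∈ Finset.Icc 1 n, qInt (2 * k - 1)) ∧
      -- the equivalent form, obtained from it by dividing out a factor `q ^ n` of each summand
      (∀ δ ∈ dyckPaths n, pathGF δ = X ^ n * pathGFTilde δ) ∧
      (∑ δ ∈ dyckPaths n, pathGFTilde δ = rankGF (FPFInvolution n) ∧
        rankGF (FPFInvolution n) = ∏ k ∈ Finset.Icc 1 n, qInt (2 * k - 1)) := by
  refine ⟨⟨FPFInvolution.gradeMinOrder n⟩, fun _ => ?_⟩
  have hsum : ∑ δ ∈ dyckPaths n, pathGF δ = X ^ n * ∑ δ ∈ dyckPaths n, pathGFTilde δ := by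
    rw [Finset.mul_sum]
    exact Finset.sum_congr rfl fun δ hδ => pathGF_eq hδ
  rw [hsum, sum_pathGFTilde_eq_prod, rankGF_eq_prod]
  exact ⟨⟨rfl, rfl⟩, fun δ hδ => pathGF_eq hδ, rfl, rfl⟩
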